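/- Let $(\Omega,\mathcal F,\mathbb P)$ be an atomless probability space. For a random variable $X$ let $Q_X(p)=\inf\{x\in\mathbb R:\mathbb P(X\le x)\ge p\}$ for $p\in(0,1]$ and $Q_X(0)=\inf\{x\in\mathbb R:\mathbb P(X\le x)>0\}$. "Increasing" is meant in the weak sense. Let $\mathcal G$ be the set of increasing functions $g:[0,1]\to\mathbb R$ that are right-continuous at $0$ and left-continuous on $(0,1]$, and let $\mathcal G_1$ (the risk spectra) be the set of nonnegative $g\in\mathcal G$ with $\int_0^1 g(t)\,dt=1$. For $g\in\mathcal G_1$ the spectral risk measure $\rho_g:L^\infty\to\mathbb R$ is $\rho_g(X)=\int_0^1 g(t)Q_X(t)\,dt$. A random vector is comonotonic if almost surely its components are increasing functions $\mathbb R\to\mathbb R$ of one common random variable. For $g\in\mathcal G$, a random vector $(X_1,\dots,X_d)$ is $g$-comonotonic if there is a random variable $Z$ with $Q_Z=g$ on $[0,1]$ such that $(X_i,Z)$ is comonotonic for every $i$. A functional $\rho:L^\infty\to\mathbb R$ is $g$-additive if $\rho(X_1+\dots+X_d)=\rho(X_1)+\dots+\rho(X_d)$ for every $d$ and every $g$-comonotonic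 $(X_1,\dots,X_d)\in(L^\infty)^d$. For $f,g\in\mathcal G$ write $f\precsim g$ if there is an increasing $h:\mathbb R\to\mathbb R$ with $f=h\circ g$ almost everywhere on $[0,1]$. Let $\mathcal I(g)$ be the set of points of strict increase of $g$, that is, of all $p\in[0,1]$ such that either $p<1$ and $g(p)<g(s)$ for all $s\in(p,1]$, or $p>0$ and $g(s)<g(p)$ for all $s\in[0,p)$. **Corollary.** Let $g_1\in\mathcal G_1$ and $g_2\in\mathcal G$. Then $\rho_{g_1}$ is $g_2$-additive if and only if $g_1\precsim g_2$. Moreover, $g_1\precsim g_2$ if and only if $\mathcal I(g_1)\subseteq\mathcal I(g_2)$. -/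

import Mathlib

open MeasureTheory Set
open scoped ENNReal

noncomputable section

namespace PartialComonotonicity

/-- A measure is atomless if every measurable set of positive measure has a measurable
subset of strictly smaller positive measure. -/
def Atomless {Ω : Type*} [MeasurableSpace Ω] (P : Measure Ω) : Prop :=
  ∀ A : Set Ω, MeasurableSet A → 0 < P A →
    ∃ B : Set Ω, MeasurableSet B ∧ B ⊆ A ∧ 0 < P B ∧ P B < P A

/-- The left quantile `VaR_p(X) = inf {x : P(X ≤ x) ≥ p}`. -/
def leftQuantile {Ω : Type*} [MeasurableSpace Ω] (P : Measure Ω) (X : Ω → ℝ) (p : ℝ) : ℝ :=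
  sInf {x : ℝ | p ≤ P.real {ω | X ω ≤ x}}

/-- The right quantile `inf {x : P(X ≤ x) > p}`. -/
def rightQuantile {Ω : Type*} [MeasurableSpace Ω] (P : Measure Ω) (X : Ω → ℝ) (p : ℝ) : ℝ :=
  sInf {x : ℝ | p < P.real {ω | X ω ≤ x}}

/-- The quantile function `Q_X` on `[0,1]`: the left quantile on `(0,1]`, and the right
quantile (the essential infimum) at `0`. -/
def quantile {Ω : Type*} [MeasurableSpace Ω] (P : Measure Ω) (X : Ω → ℝ) (p : ℝ) : ℝ :=
  if p = 0 then rightQuantile P X 0 else leftQuantile P X p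

/-- A random vector is comonotonic if, almost surely, its components are increasing functions
of one random variable. -/
def Comonotonic {Ω : Type*} [MeasurableSpace Ω] (P : Measure Ω) {d : ℕ}
    (X : Fin d → Ω → ℝ) : Prop :=
  ∃ (Z : Ω → ℝ) (f : Fin d → ℝ → ℝ), Measurable Z ∧ (∀ i, Monotone (f i)) ∧
    ∀ᵐ ω ∂P, ∀ i, X i ω = f i (Z ω)

/-- The class `𝒢` of increasing functions on `[0,1]` that are left-continuous on `(0,1]` and
right-continuous at `0`. Functions on `[0,1]` are represented by functions on `ℝ`, of which
only the values on `[0,1]` are ever used. -/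
structure IsG (g : ℝ → ℝ) : Prop where
  mono : MonotoneOn g (Icc 0 1)
  left_cont : ∀ p ∈ Ioc (0 : ℝ) 1, ContinuousWithinAt g (Icc 0 p) p
  right_cont_zero : ContinuousWithinAt g (Icc 0 1) 0

/-- The class `𝒢₁` of risk spectra: the nonnegative members of `𝒢` that integrate to one. -/
structure IsRiskSpectrum (g : ℝ → ℝ) : Prop extends IsG g where
  nonneg : ∀ t ∈ Icc (0 : ℝ) 1, 0 ≤ g t
  integral_eq_one : ∫ t in (0 : ℝ)..1, g t = 1

/-- The functional `ρ_g(X) = ∫₀¹ g(t) Q_X(t) dt`. -/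
def spectralRisk {Ω : Type*} [MeasurableSpace Ω] (P : Measure Ω) (g : ℝ → ℝ)
    (X : Ω → ℝ) : ℝ :=
  ∫ t in (0 : ℝ)..1, g t * quantile P X t

/-- `g`-comonotonicity: there is a random variable with quantile function `g` that is
comonotonic with each component. -/
def GComonotonic {Ω : Type*} [MeasurableSpace Ω] (P : Measure Ω) (g : ℝ → ℝ) {d : ℕ}
    (X : Fin d → Ω → ℝ) : Prop :=
  ∃ Z : Ω → ℝ, Measurable Z ∧ (∀ p ∈ Icc (0 : ℝ) 1, quantile P Z p = g p) ∧
    ∀ i, Comonotonic P ![X i, Z]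

/-- `g`-additivity of a risk functional with domain `L^∞`. -/
def GAdditive {Ω : Type*} [MeasurableSpace Ω] (P : Measure Ω) (g : ℝ → ℝ)
    (ρ : (Ω → ℝ) → ℝ) : Prop :=
  ∀ (d : ℕ) (X : Fin d → Ω → ℝ), (∀ i, MemLp (X i) ∞ P) → GComonotonic P g X →
    ρ (fun ω => ∑ i, X i ω) = ∑ i, ρ (X i)

/-- The preorder `f ≾ g`: almost everywhere on `[0,1]`, `f` is an increasing function of `g`. -/
def Precedes (f g : ℝ → ℝ) : Prop :=
  ∃ h : ℝ → ℝ, Monotone h ∧ ∀ᵐ t ∂(volume.restrict (Icc (0 : ℝ) 1)), f t = h (g t)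

/-- `p` is a point of strict increase on the right of `g`. -/
def IsPSIR (g : ℝ → ℝ) (p : ℝ) : Prop :=
  p ∈ Ico (0 : ℝ) 1 ∧ ∀ s ∈ Ioc p 1, g p < g s

/-- `p` is a point of strict increase on the left of `g`. -/
def IsPSIL (g : ℝ → ℝ) (p : ℝ) : Prop :=
  p ∈ Ioc (0 : ℝ) 1 ∧ ∀ s ∈ Ico 0 p, g s < g p

/-- The set `𝓘(g)` of points of strict increase of `g` in `[0,1]`. -/
def strictIncreaseSet (g : ℝ → ℝ) : Set ℝ :=
  {p | IsPSIR g p ∨ IsPSIL g p}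

end PartialComonotonicity

end

namespace PartialComonotonicity

/-! All three conditions are compared with `ConstantOnPlateaus`: wherever `g₂` is flat on `[a,b]`,
`g₁` is constant on `(a,b]`. One-sided continuity makes this equivalent both to `Precedes` and to
the inclusion of the sets of strict increase.

Sufficiency: if `g₁ = k ∘ g₂` almost everywhere and `Z` has quantile function `g₂`, then `ρ(Y) =
E[k(Z) Y]` for every `Y` comonotonic with `Z` (`integral_mul_eq_of_monotone`). The sum of the
components is again comonotonic with `Z` (`exists_monotone_of_add`), so additivity is linearity of
the expectation.

Necessity: let `g₂` be flat on `[a,b]` with midpoint `c`, let `U` be uniform (`exists_uniform`), and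
let `V` be `U` reflected inside `(a,b)`. Then `g₂(U) = g₂(V)`, so the indicators of `U > c` and `V >
c` are `g₂`-comonotonic, while their sum is almost surely `1_{U>a} + 1_{U>b}`. With `F(x) = ∫_x^1
g₁`, additivity reads `F(a) + F(b) = 2 F(c)`. As `g₁` is increasing, `F` is concave; equality at the
midpoint makes it affine on `[a,b]`, hence `g₁` constant on `(a,b]`. -/

/-! ### Uniform random variables on atomless spaces -/

/-- A nonempty family of measurable sets that is totally ordered up to null sets has a
supremum up to null sets, and its measure is the supremum of the measures. -/
theorem exists_ae_supremum_of_chain {Ω : Type*} [MeasurableSpace Ω] (P : Measure Ω)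
    [IsFiniteMeasure P] (S : Set (Set Ω)) (hne : S.Nonempty)
    (hS : ∀ A ∈ S, MeasurableSet A) (hchain : ∀ A ∈ S, ∀ B ∈ S, A ≤ᵐ[P] B ∨ B ≤ᵐ[P] A) :
    ∃ D, MeasurableSet D ∧ (∀ A ∈ S, A ≤ᵐ[P] D) ∧
      (∀ E : Set Ω, (∀ A ∈ S, A ≤ᵐ[P] E) → D ≤ᵐ[P] E) ∧
      ∀ t : ℝ, (∀ A ∈ S, P.real A ≤ t) → P.real D ≤ t := by
  have hbdd : BddAbove (P.real '' S) := by
    refine ⟨P.real univ, ?_⟩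
    rintro _ ⟨A, -, rfl⟩
    exact measureReal_mono (subset_univ A)
  obtain ⟨u, -, hu, huS⟩ := exists_seq_tendsto_sSup (hne.image P.real) hbdd
  choose C hCS hCu using huS
  -- Finite unions from a chain stay below a member, so bounds on the members' measures pass to the
  -- countable union.
  have hacc : ∀ n, ∃ A ∈ S, Set.accumulate C n ≤ᵐ[P] A := by
    intro n
    induction n with
    | zero => exact ⟨C 0, hCS 0, by rw [Set.accumulate_zero_nat]; exact Filter.EventuallyLE.refl _ _⟩
    | succ n ih =>
      obtain ⟨A, hA, hle⟩ := ih
      rw [Set.accumulate_succ]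
      rcases hchain A hA _ (hCS (n + 1)) with h | h
      · refine ⟨_, hCS (n + 1), ?_⟩
        filter_upwards [hle, h] with ω h1 h2 h3
        rcases h3 with h3 | h3
        exacts [h2 (h1 h3), h3]
      · refine ⟨A, hA, ?_⟩
        filter_upwards [hle, h] with ω h1 h2 h3
        rcases h3 with h3 | h3
        exacts [h1 h3, h2 h3]
  have hmeas : MeasurableSet (⋃ n, C n) := MeasurableSet.iUnion fun n => hS _ (hCS n)
  have hle : ∀ E : Set Ω, (∀ n, C n ≤ᵐ[P] E) → (⋃ n, C n) ≤ᵐ[P] E := by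
    intro E hE
    filter_upwards [ae_all_iff.2 hE] with ω hω h
    obtain ⟨n, hn⟩ := mem_iUnion.1 h
    exact hω n hn
  refine ⟨⋃ n, C n, hmeas, ?_, fun E hE => hle E fun n => hE _ (hCS n), ?_⟩
  · intro A hA
    -- Otherwise `A` lies above every `C n`; the union already has maximal measure, so it equals `A`
    -- up to a null set.
    by_cases h : ∃ n, A ≤ᵐ[P] C n
    · obtain ⟨n, hn⟩ := h
      exact hn.trans (subset_iUnion C n).eventuallyLE
    · push Not at h
      have h1 : (⋃ n, C n) ≤ᵐ[P] A :=
        hle A fun n => (hchain A hA _ (hCS n)).resolve_left (h n)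
      have h2 : P.real A ≤ P.real (⋃ n, C n) := by
        refine (le_csSup hbdd ⟨A, hA, rfl⟩).trans (le_of_tendsto' hu fun n => ?_)
        rw [← hCu n]
        exact measureReal_mono (subset_iUnion C n)
      have h3 : P A ≤ P (⋃ n, C n) := by
        rwa [measureReal_def, measureReal_def,
          ENNReal.toReal_le_toReal (measure_ne_top _ _) (measure_ne_top _ _)] at h2
      exact (ae_eq_of_ae_subset_of_measure_ge h1 h3 hmeas.nullMeasurableSet
        (measure_ne_top _ _)).symm.le
  · intro t ht
    have h1 := (ENNReal.tendsto_toReal (measure_ne_top P (⋃ n, C n))).comp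
      (tendsto_measure_iUnion_accumulate (μ := P) (f := C))
    refine le_of_tendsto' h1 fun n => ?_
    obtain ⟨A, hA, hAn⟩ := hacc n
    exact (ENNReal.toReal_mono (measure_ne_top _ _) (measure_mono_ae hAn)).trans (ht A hA)

/-- In an atomless probability space there is a family of measurable sets, totally ordered up to
null sets, whose measures exhaust `[0,1]`. -/
theorem exists_chain_measureReal_eq {Ω : Type*} [MeasurableSpace Ω] (P : Measure Ω)
    [IsProbabilityMeasure P] (hP : Atomless P) :
    ∃ C : ℝ → Set Ω, (∀ t, MeasurableSet (C t)) ∧ (∀ t ∈ Icc (0 : ℝ) 1, P.real (C t) = t) ∧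
      ∀ s ∈ Icc (0 : ℝ) 1, ∀ t ∈ Icc (0 : ℝ) 1, s ≤ t → C s ≤ᵐ[P] C t := by
  -- A maximal chain for almost sure inclusion cannot skip a measure `t`: the gap around `t` would
  -- be filled by splitting its non-null difference set.
  let r : {A : Set Ω // MeasurableSet A} → {A : Set Ω // MeasurableSet A} → Prop :=
    fun A B => A.1 ≤ᵐ[P] B.1
  obtain ⟨hchain, hmax⟩ := maxChain_spec (r := r)
  set M := maxChain r
  have hcomp : ∀ A ∈ M, ∀ B ∈ M, A.1 ≤ᵐ[P] B.1 ∨ B.1 ≤ᵐ[P] A.1 := by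
    intro A hA B hB
    by_cases h : A = B
    · left; rw [h]; exact Filter.EventuallyLE.refl _ _
    · exact hchain hA hB h
  have hmem : ∀ (D : Set Ω) (hD : MeasurableSet D),
      (∀ A ∈ M, D ≤ᵐ[P] A.1 ∨ A.1 ≤ᵐ[P] D) → (⟨D, hD⟩ : {A : Set Ω // MeasurableSet A}) ∈ M := by
    intro D hD h
    have := hmax (hchain.insert (a := ⟨D, hD⟩) fun B hB _ => h B hB) (subset_insert _ _)
    rw [this]
    exact mem_insert _ _
  have hlt : ∀ A ∈ M, ∀ B ∈ M, P.real A.1 < P.real B.1 → A.1 ≤ᵐ[P] B.1 := by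
    intro A hA B hB h
    refine (hcomp A hA B hB).resolve_right fun h' => h.not_ge ?_
    exact ENNReal.toReal_mono (measure_ne_top _ _) (measure_mono_ae h')
  have hcompl : ∀ {A B : Set Ω}, A ≤ᵐ[P] B → Bᶜ ≤ᵐ[P] Aᶜ := by
    intro A B h
    filter_upwards [h] with ω h1 h2 h3
    exact h2 (h1 h3)
  have hex : ∀ t ∈ Icc (0 : ℝ) 1, ∃ A ∈ M, P.real A.1 = t := by
    rintro t ⟨ht0, ht1⟩
    by_contra! hne
    have hempty : (⟨∅, MeasurableSet.empty⟩ : {A : Set Ω // MeasurableSet A}) ∈ M :=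
      hmem _ _ fun A _ => Or.inl (empty_subset _).eventuallyLE
    have huniv : (⟨univ, MeasurableSet.univ⟩ : {A : Set Ω // MeasurableSet A}) ∈ M :=
      hmem _ _ fun A _ => Or.inr (subset_univ _).eventuallyLE
    have ht0' : 0 < t := lt_of_le_of_ne ht0 (by simpa using hne _ hempty)
    have ht1' : t < 1 := lt_of_le_of_ne ht1 (by simpa using (hne _ huniv).symm)
    obtain ⟨D, hDm, hD1, hD2, hD3⟩ := exists_ae_supremum_of_chain P
      {A | ∃ B ∈ M, P.real B.1 < t ∧ B.1 = A} ⟨∅, _, hempty, by simpa using ht0', rfl⟩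
      (by rintro _ ⟨B, -, -, rfl⟩; exact B.2)
      (by rintro _ ⟨A, hA, -, rfl⟩ _ ⟨B, hB, -, rfl⟩; exact hcomp A hA B hB)
    -- Suprema of complements: `Eᶜ` is the infimum of the members of measure above `t`.
    obtain ⟨E, hEm, hE1, hE2, hE3⟩ := exists_ae_supremum_of_chain P
      {A | ∃ B ∈ M, t < P.real B.1 ∧ B.1ᶜ = A} ⟨∅, _, huniv, by simpa using ht1', by simp⟩
      (by rintro _ ⟨B, -, -, rfl⟩; exact B.2.compl)
      (by
        rintro _ ⟨A, hA, -, rfl⟩ _ ⟨B, hB, -, rfl⟩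
        exact (hcomp B hB A hA).imp hcompl hcompl)
    have hED : D ≤ᵐ[P] Eᶜ := by
      refine hD2 _ ?_
      rintro _ ⟨A, hA, hAt, rfl⟩
      rw [← compl_compl A.1]
      refine hcompl (hE2 _ ?_)
      rintro _ ⟨B, hB, hBt, rfl⟩
      exact hcompl (hlt A hA B hB (hAt.trans hBt))
    have hEB : ∀ B ∈ M, t < P.real B.1 → Eᶜ ≤ᵐ[P] B.1 := by
      intro B hB hBt
      rw [← compl_compl B.1]
      exact hcompl (hE1 _ ⟨B, hB, hBt, rfl⟩)
    have hDB : ∀ B ∈ M, P.real B.1 < t → B.1 ≤ᵐ[P] D := fun B hB hBt => hD1 _ ⟨B, hB, hBt, rfl⟩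
    have hDM := hmem D hDm fun A hA => (hne A hA).lt_or_gt.elim
      (fun h => Or.inr (hDB A hA h)) (fun h => Or.inl (hED.trans (hEB A hA h)))
    have hEM := hmem Eᶜ hEm.compl fun A hA => (hne A hA).lt_or_gt.elim
      (fun h => Or.inr ((hDB A hA h).trans hED)) (fun h => Or.inl (hEB A hA h))
    have hDt : P.real D < t := lt_of_le_of_ne
      (hD3 t (by rintro _ ⟨A, -, hAt, rfl⟩; exact hAt.le)) (hne _ hDM)
    have hEt : t < P.real Eᶜ := by
      refine lt_of_le_of_ne ?_ (hne _ hEM).symm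
      have h1 : P.real E ≤ 1 - t := hE3 _ (by
        rintro _ ⟨A, -, hAt, rfl⟩
        rw [probReal_compl_eq_one_sub A.2]
        linarith)
      rw [probReal_compl_eq_one_sub hEm]
      linarith
    have hpos : 0 < P (Eᶜ \ D) := by
      rw [pos_iff_ne_zero]
      intro h0
      have h1 : Eᶜ ≤ᵐ[P] D := ae_le_set.2 h0
      have h2 : P.real Eᶜ ≤ P.real D :=
        ENNReal.toReal_mono (measure_ne_top _ _) (measure_mono_ae h1)
      linarith
    obtain ⟨B, hBm, hBsub, hB0, hB1⟩ := hP _ (hEm.compl.diff hDm) hpos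
    have hFE : (D ∪ B : Set Ω) ≤ᵐ[P] Eᶜ := by
      filter_upwards [hED] with ω h1 h2
      rcases h2 with h2 | h2
      exacts [h1 h2, (hBsub h2).1]
    have hDF : D ≤ᵐ[P] (D ∪ B : Set Ω) := subset_union_left.eventuallyLE
    have hFM := hmem (D ∪ B) (hDm.union hBm) fun A hA => (hne A hA).lt_or_gt.elim
      (fun h => Or.inr ((hDB A hA h).trans hDF)) (fun h => Or.inl (hFE.trans (hEB A hA h)))
    -- Below `t`, `D ∪ B` lies under the supremum `D`, so `B` is null; above `t`, it lies over `Eᶜ`,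
    -- so `B` exhausts `Eᶜ \ D`. Both contradict the choice of `B`.
    rcases (hne _ hFM).lt_or_gt with h | h
    · have h1 : B ≤ᵐ[P] (∅ : Set Ω) := by
        filter_upwards [hDB _ hFM h] with ω h1 h2
        exact ((hBsub h2).2 (h1 (Or.inr h2))).elim
      have h2 := measure_mono_ae h1
      rw [measure_empty] at h2
      exact hB0.not_ge h2
    · have h1 : (Eᶜ \ D : Set Ω) ≤ᵐ[P] B := by
        filter_upwards [hEB _ hFM h] with ω h1 h2
        exact (h1 h2.1).resolve_left h2.2
      exact hB1.not_ge (measure_mono_ae h1)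
  choose! C hC using hex
  refine ⟨fun t => (C t).1, fun t => (C t).2, fun t ht => (hC t ht).2, ?_⟩
  intro s hs t ht hst
  rcases hst.eq_or_lt with rfl | hst
  · exact Filter.EventuallyLE.refl _ _
  · refine hlt _ (hC s hs).1 _ (hC t ht).1 ?_
    rwa [(hC s hs).2, (hC t ht).2]

/-- An atomless probability space carries a random variable uniform on `[0,1]`. -/
theorem exists_uniform {Ω : Type*} [MeasurableSpace Ω] (P : Measure Ω)
    [IsProbabilityMeasure P] (hP : Atomless P) :
    ∃ U : Ω → ℝ, Measurable U ∧ (∀ ω, U ω ∈ Icc (0 : ℝ) 1) ∧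
      P.map U = volume.restrict (Icc (0 : ℝ) 1) := by
  obtain ⟨C, hCm, hC, hCle⟩ := exists_chain_measureReal_eq P hP
  -- Rational indices make `{U < x}` a countable union; inserting `1` keeps the infimum over a
  -- nonempty set.
  let S : Ω → Set ℝ := fun ω => insert 1 {x | ∃ q : ℚ, (q : ℝ) ∈ Icc (0 : ℝ) 1 ∧ ω ∈ C q ∧ q = x}
  have hS : ∀ ω, ∀ x ∈ S ω, x ∈ Icc (0 : ℝ) 1 := by
    rintro ω x (rfl | ⟨q, hq, -, rfl⟩)
    exacts [⟨zero_le_one, le_rfl⟩, hq]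
  have hne : ∀ ω, (S ω).Nonempty := fun ω => ⟨1, mem_insert _ _⟩
  have hbdd : ∀ ω, BddBelow (S ω) := fun ω => ⟨0, fun x hx => (hS ω x hx).1⟩
  let U : Ω → ℝ := fun ω => sInf (S ω)
  have hU : ∀ ω, U ω ∈ Icc (0 : ℝ) 1 := fun ω =>
    ⟨le_csInf (hne ω) fun x hx => (hS ω x hx).1, csInf_le (hbdd ω) (mem_insert _ _)⟩
  have hlt : ∀ x ≤ 1, {ω | U ω < x} =
      ⋃ q : ℚ, ⋃ _ : (q : ℝ) ∈ Icc (0 : ℝ) 1 ∧ (q : ℝ) < x, C q := by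
    intro x hx
    ext ω
    simp only [mem_ofPred_eq, mem_iUnion, exists_prop]
    rw [csInf_lt_iff (hbdd ω) (hne ω)]
    constructor
    · rintro ⟨y, rfl | ⟨q, hq, hω, rfl⟩, hy⟩
      · exact absurd hx (not_le.2 hy)
      · exact ⟨q, ⟨hq, hy⟩, hω⟩
    · rintro ⟨q, ⟨hq, hqx⟩, hω⟩
      exact ⟨q, Or.inr ⟨q, hq, hω, rfl⟩, hqx⟩
  have hmeas : ∀ x ≤ 1, MeasurableSet {ω | U ω < x} := by
    intro x hx
    rw [hlt x hx]
    exact MeasurableSet.iUnion fun q => MeasurableSet.iUnion fun _ => hCm _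
  have hUm : Measurable U := by
    refine measurable_of_Iio fun x => ?_
    rcases le_or_gt x 1 with hx | hx
    · exact hmeas x hx
    · have : U ⁻¹' Iio x = univ := eq_univ_of_forall fun ω => (hU ω).2.trans_lt hx
      rw [this]
      exact MeasurableSet.univ
  have hPlt_le : ∀ x ≤ 1, 0 ≤ x → P.real {ω | U ω < x} ≤ x := by
    intro x hx hx0
    refine (ENNReal.toReal_mono (measure_ne_top _ _) (measure_mono_ae ?_)).trans_eq
      (hC x ⟨hx0, hx⟩)
    rw [hlt x hx]
    have : ∀ᵐ ω ∂P, ∀ q : ℚ, (q : ℝ) ∈ Icc (0 : ℝ) 1 ∧ (q : ℝ) < x → ω ∈ C q → ω ∈ C x := by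
      refine ae_all_iff.2 fun q => ?_
      by_cases h : (q : ℝ) ∈ Icc (0 : ℝ) 1 ∧ (q : ℝ) < x
      · filter_upwards [hCle q h.1 x ⟨hx0, hx⟩ h.2.le] with ω hω _
        exact hω
      · exact Filter.Eventually.of_forall fun ω h' => absurd h' h
    filter_upwards [this] with ω h1 h2
    obtain ⟨q, hq, hω⟩ := mem_iUnion₂.1 h2
    exact h1 q hq hω
  have hPlt_ge : ∀ x ≤ 1, x ≤ P.real {ω | U ω < x} := by
    intro x hx
    refine le_of_forall_lt fun y hy => ?_
    rcases lt_or_ge x 0 with hx0 | hx0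
    · exact (hy.trans hx0).trans_le measureReal_nonneg
    rcases hx0.eq_or_lt with rfl | hx0
    · exact hy.trans_le measureReal_nonneg
    obtain ⟨q, hq1, hq2⟩ := exists_rat_btwn (max_lt hy hx0)
    have hq : (q : ℝ) ∈ Icc (0 : ℝ) 1 :=
      ⟨(le_max_right _ _).trans hq1.le, hq2.le.trans hx⟩
    refine ((le_max_left _ _).trans_lt hq1).trans_le ?_
    rw [← hC q hq, hlt x hx]
    exact measureReal_mono (subset_iUnion₂ (s := fun (q : ℚ)
      (_ : (q : ℝ) ∈ Icc (0 : ℝ) 1 ∧ (q : ℝ) < x) => C q) q ⟨hq, hq2⟩)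
      (measure_ne_top _ _)
  have hPle : ∀ x ∈ Icc (0 : ℝ) 1, P.real {ω | U ω ≤ x} = x := by
    rintro x ⟨hx0, hx1⟩
    apply le_antisymm
    · rcases hx1.eq_or_lt with rfl | hx1
      · exact measureReal_le_one
      refine le_of_forall_gt_imp_ge_of_dense fun y hy => ?_
      have hy' : x < min y 1 := lt_min hy hx1
      refine (measureReal_mono fun ω hω => ?_).trans
        ((hPlt_le (min y 1) (min_le_right _ _) (hx0.trans hy'.le)).trans (min_le_left _ _))
      exact lt_of_le_of_lt hω hy'
    · exact (hPlt_ge x hx1).trans (measureReal_mono fun ω (hω : U ω < x) => hω.le)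
  refine ⟨U, hUm, hU, Measure.ext_of_Iic _ _ fun x => ?_⟩
  have hvol : (Iic x ∩ Icc 0 1 : Set ℝ) = Icc 0 (min x 1) := by
    ext y
    simp only [mem_inter_iff, mem_Iic, mem_Icc, le_min_iff]
    tauto
  rw [Measure.map_apply hUm measurableSet_Iic, Measure.restrict_apply measurableSet_Iic, hvol,
    Real.volume_Icc, sub_zero]
  rcases lt_or_ge x 0 with hx | hx
  · have h1 : U ⁻¹' Iic x = ∅ := by
      ext ω
      simpa using hx.trans_le (hU ω).1
    rw [h1, measure_empty, ENNReal.ofReal_of_nonpos ((min_le_left _ _).trans hx.le)]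
  · have h1 : U ⁻¹' Iic x = {ω | U ω ≤ min x 1} := by
      ext ω
      simpa using fun _ => (hU ω).2
    rw [h1, ← ofReal_measureReal, hPle _ ⟨le_min hx zero_le_one, min_le_right _ _⟩]

/-! ### Quantile functions and laws -/

/-- The infimum is attained because the distribution function is right-continuous; for `u` in the
open interval its limits at `±∞` make the set nonempty and bounded below. -/
theorem leftQuantile_le_iff {Ω : Type*} [MeasurableSpace Ω] {P : Measure Ω}
    [IsProbabilityMeasure P] {X : Ω → ℝ} (hX : AEMeasurable X P) {u : ℝ} (hu : u ∈ Ioo (0 : ℝ) 1)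
    (x : ℝ) : leftQuantile P X u ≤ x ↔ u ≤ P.real {ω | X ω ≤ x} := by
  have := Measure.isProbabilityMeasure_map hX
  have hF : ∀ x, P.real {ω | X ω ≤ x} = ProbabilityTheory.cdf (P.map X) x := by
    intro x
    rw [ProbabilityTheory.cdf_eq_real, measureReal_def, measureReal_def,
      Measure.map_apply_of_aemeasurable hX measurableSet_Iic]
    rfl
  unfold leftQuantile
  simp only [hF]
  set F := ProbabilityTheory.cdf (P.map X)
  obtain ⟨a, ha⟩ := ((ProbabilityTheory.tendsto_cdf_atBot (P.map X)).eventually_lt_const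
    hu.1).exists
  obtain ⟨b, hb⟩ := ((ProbabilityTheory.tendsto_cdf_atTop (P.map X)).eventually_const_lt
    hu.2).exists
  have hbdd : BddBelow {x : ℝ | u ≤ F x} := by
    refine ⟨a, fun y (hy : u ≤ F y) => ?_⟩
    by_contra! h
    exact (hy.trans (F.mono h.le)).not_gt ha
  have hne : {x : ℝ | u ≤ F x}.Nonempty := ⟨b, hb.le⟩
  refine ⟨fun h => ?_, fun h => csInf_le hbdd h⟩
  have hq : u ≤ F (sInf {x : ℝ | u ≤ F x}) := by
    refine ge_of_tendsto ((F.right_continuous _).mono_left (nhdsWithin_mono _ Ioi_subset_Ici_self)) ?_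
    filter_upwards [self_mem_nhdsWithin] with y hy
    obtain ⟨z, hz, hzy⟩ := (csInf_lt_iff hbdd hne).1 hy
    exact le_trans hz (F.mono hzy.le)
  exact hq.trans (F.mono h)

theorem monotoneOn_leftQuantile {Ω : Type*} [MeasurableSpace Ω] {P : Measure Ω}
    [IsProbabilityMeasure P] {X : Ω → ℝ} (hX : AEMeasurable X P) :
    MonotoneOn (leftQuantile P X) (Ioo 0 1) := by
  intro u hu v hv huv
  rw [leftQuantile_le_iff hX hu]
  exact huv.trans ((leftQuantile_le_iff hX hv _).1 le_rfl)

/-- The quantile function of `X`, as a random variable on the unit interval, has the law of `X`. -/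
theorem map_leftQuantile {Ω : Type*} [MeasurableSpace Ω] {P : Measure Ω}
    [IsProbabilityMeasure P] {X : Ω → ℝ} (hX : AEMeasurable X P) :
    (volume.restrict (Ioo (0 : ℝ) 1)).map (leftQuantile P X) = P.map X := by
  have hq : AEMeasurable (leftQuantile P X) (volume.restrict (Ioo (0 : ℝ) 1)) :=
    aemeasurable_restrict_of_monotoneOn measurableSet_Ioo (monotoneOn_leftQuantile hX)
  have : IsFiniteMeasure ((volume.restrict (Ioo (0 : ℝ) 1)).map (leftQuantile P X)) :=
    inferInstance
  refine Measure.ext_of_Iic _ _ fun x => ?_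
  rw [Measure.map_apply_of_aemeasurable hq measurableSet_Iic,
    Measure.map_apply_of_aemeasurable hX measurableSet_Iic,
    Measure.restrict_apply' measurableSet_Ioo]
  have h1 : P (X ⁻¹' Iic x) = ENNReal.ofReal (P.real {ω | X ω ≤ x}) := by
    rw [ofReal_measureReal]
    rfl
  have hc1 : P.real {ω | X ω ≤ x} ≤ 1 := measureReal_le_one
  rw [h1]
  apply le_antisymm
  · refine (measure_mono (t := Icc 0 (P.real {ω | X ω ≤ x})) ?_).trans_eq ?_
    · rintro u ⟨hu, hu'⟩
      exact ⟨hu'.1.le, (leftQuantile_le_iff hX hu' x).1 hu⟩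
    · rw [Real.volume_Icc, sub_zero]
  · refine Eq.trans_le ?_ (measure_mono (s := Ioo 0 (P.real {ω | X ω ≤ x})) ?_)
    · rw [Real.volume_Ioo, sub_zero]
    · intro u hu
      have hu' : u ∈ Ioo (0 : ℝ) 1 := ⟨hu.1, hu.2.trans_le hc1⟩
      exact ⟨(leftQuantile_le_iff hX hu' x).2 hu.2.le, hu'⟩

/-- A monotone function on the unit interval that has the law of `X` is almost everywhere
the quantile function of `X`. -/
theorem leftQuantile_ae_eq_of_map_eq {Ω : Type*} [MeasurableSpace Ω] {P : Measure Ω}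
    [IsProbabilityMeasure P] {X : Ω → ℝ} (hX : AEMeasurable X P) {k : ℝ → ℝ}
    (hk : MonotoneOn k (Ioo 0 1)) (h : P.map X = (volume.restrict (Ioo (0 : ℝ) 1)).map k) :
    ∀ᵐ u ∂volume.restrict (Ioo (0 : ℝ) 1), leftQuantile P X u = k u := by
  have hkm : AEMeasurable k (volume.restrict (Ioo (0 : ℝ) 1)) :=
    aemeasurable_restrict_of_monotoneOn measurableSet_Ioo hk
  have hF : ∀ x, P.real {ω | X ω ≤ x} = volume.real (k ⁻¹' Iic x ∩ Ioo 0 1) := by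
    intro x
    have h1 := congrArg (fun μ => μ (Iic x)) h
    rw [Measure.map_apply_of_aemeasurable hkm measurableSet_Iic,
      Measure.map_apply_of_aemeasurable hX measurableSet_Iic,
      Measure.restrict_apply' measurableSet_Ioo] at h1
    rw [measureReal_def, measureReal_def, ← h1]
    rfl
  -- Only continuity points of `k` matter, since a monotone function has countably many
  -- discontinuities.
  filter_upwards [ae_restrict_mem measurableSet_Ioo,
    ae_restrict_of_ae (hk.countable_not_continuousWithinAt.ae_notMem volume)] with u hu hcont
  have hcont : ContinuousWithinAt k (Ioo 0 1) u := by
    by_contra hc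
    exact hcont ⟨hu, hc⟩
  have hfin : ∀ s : Set ℝ, volume (s ∩ Ioo 0 1) ≠ ∞ := fun s =>
    measure_ne_top_of_subset inter_subset_right (by simp)
  apply le_antisymm
  · rw [leftQuantile_le_iff hX hu, hF]
    refine Eq.trans_le ?_ (measureReal_mono (s₁ := Ioo 0 u) ?_ (hfin _))
    · rw [Real.volume_real_Ioo_of_le hu.1.le, sub_zero]
    · intro v hv
      have hv' : v ∈ Ioo (0 : ℝ) 1 := ⟨hv.1, hv.2.trans hu.2⟩
      exact ⟨hk hv' hu hv.2.le, hv'⟩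
  -- If `k u` exceeded the quantile `q`, continuity would confine `{k ≤ q}` to `[0,v]` with `v < u`,
  -- yet its measure is at least `u`.
  · by_contra! hlt
    have h1 := (leftQuantile_le_iff hX hu (leftQuantile P X u)).1 le_rfl
    rw [hF] at h1
    have h2 : ∀ᶠ v in nhds u, leftQuantile P X u < k v := by
      have := hcont.eventually_const_lt hlt
      rwa [nhdsWithin_eq_nhds.2 (Ioo_mem_nhds hu.1 hu.2)] at this
    obtain ⟨a, hau, ha⟩ := exists_Ioc_subset_of_mem_nhds h2 ⟨0, hu.1⟩
    have hv : max a 0 < u := max_lt hau hu.1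
    obtain ⟨v, hav, hvu⟩ := exists_between hv
    have hv0 : 0 < v := (le_max_right _ _).trans_lt hav
    have h3 : volume.real (k ⁻¹' Iic (leftQuantile P X u) ∩ Ioo 0 1) ≤ v := by
      refine (measureReal_mono (s₂ := Icc 0 v) ?_ (by simp)).trans_eq ?_
      · rintro w ⟨hw, hw'⟩
        refine ⟨hw'.1.le, ?_⟩
        by_contra! hvw
        have h4 : leftQuantile P X u < k v := ha ⟨(le_max_left _ _).trans_lt hav, hvu.le⟩
        exact (h4.trans_le (hk ⟨hv0, hvu.trans hu.2⟩ hw' hvw.le)).not_ge hw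
      · rw [Real.volume_real_Icc_of_le hv0.le, sub_zero]
    linarith

/-- `f ∘ Q_W` is monotone and has the law of `f(W)`. The equality is only almost everywhere, as `f`
need not be left-continuous. -/
theorem leftQuantile_ae_eq_comp {Ω : Type*} [MeasurableSpace Ω] {P : Measure Ω}
    [IsProbabilityMeasure P] {W X : Ω → ℝ} (hW : AEMeasurable W P) {f : ℝ → ℝ} (hf : Monotone f)
    (hX : X =ᵐ[P] fun ω => f (W ω)) :
    ∀ᵐ u ∂volume.restrict (Ioo (0 : ℝ) 1), leftQuantile P X u = f (leftQuantile P W u) := by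
  have hq : AEMeasurable (leftQuantile P W) (volume.restrict (Ioo (0 : ℝ) 1)) :=
    aemeasurable_restrict_of_monotoneOn measurableSet_Ioo (monotoneOn_leftQuantile hW)
  have hXm : AEMeasurable X P := (hf.measurable.comp_aemeasurable hW).congr hX.symm
  refine leftQuantile_ae_eq_of_map_eq hXm
    (k := fun u => f (leftQuantile P W u)) (hf.comp_monotoneOn (monotoneOn_leftQuantile hW)) ?_
  rw [Measure.map_congr hX]
  change P.map (f ∘ W) = Measure.map (f ∘ leftQuantile P W) _
  rw [← AEMeasurable.map_map_of_aemeasurable hf.measurable.aemeasurable hW,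
    ← AEMeasurable.map_map_of_aemeasurable hf.measurable.aemeasurable hq, map_leftQuantile hW]

/-- A comonotonic pair has the joint law of its two quantile functions on `(0,1)`: push to the law
of `W`, then pull back along `Q_W`. -/
theorem integral_mul_eq_of_monotone {Ω : Type*} [MeasurableSpace Ω] {P : Measure Ω}
    [IsProbabilityMeasure P] {W X Z : Ω → ℝ} (hW : AEMeasurable W P) {f₀ f₁ h : ℝ → ℝ}
    (hf₀ : Monotone f₀) (hf₁ : Monotone f₁) (hh : Monotone h)
    (hX : X =ᵐ[P] fun ω => f₀ (W ω)) (hZ : Z =ᵐ[P] fun ω => f₁ (W ω)) :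
    ∫ ω, h (Z ω) * X ω ∂P =
      ∫ u in Ioo (0 : ℝ) 1, h (leftQuantile P Z u) * leftQuantile P X u := by
  have hq : AEMeasurable (leftQuantile P W) (volume.restrict (Ioo (0 : ℝ) 1)) :=
    aemeasurable_restrict_of_monotoneOn measurableSet_Ioo (monotoneOn_leftQuantile hW)
  have hφ : Measurable fun w => h (f₁ w) * f₀ w :=
    (hh.measurable.comp hf₁.measurable).mul hf₀.measurable
  calc ∫ ω, h (Z ω) * X ω ∂P = ∫ ω, (fun w => h (f₁ w) * f₀ w) (W ω) ∂P := by
        refine integral_congr_ae ?_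
        filter_upwards [hX, hZ] with ω h1 h2
        rw [h1, h2]
    _ = ∫ w, h (f₁ w) * f₀ w ∂(P.map W) := (integral_map hW hφ.aestronglyMeasurable).symm
    _ = ∫ u in Ioo (0 : ℝ) 1, (fun w => h (f₁ w) * f₀ w) (leftQuantile P W u) := by
        rw [← map_leftQuantile hW, integral_map hq hφ.aestronglyMeasurable]
    _ = _ := by
        refine integral_congr_ae ?_
        filter_upwards [leftQuantile_ae_eq_comp hW hf₀ hX, leftQuantile_ae_eq_comp hW hf₁ hZ]
          with u h1 h2
        rw [h1, h2]

/-- Two bounded random variables of which the first never decreases when the second strictly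
increases are increasing functions of their sum. -/
theorem exists_monotone_of_add {Ω : Type*} {X Z : Ω → ℝ} {A : Set Ω} {a b : ℝ}
    (hXA : ∀ ω ∈ A, |X ω| ≤ a) (hZA : ∀ ω ∈ A, |Z ω| ≤ b)
    (h : ∀ ω ∈ A, ∀ ω' ∈ A, Z ω < Z ω' → X ω ≤ X ω') :
    ∃ f₀ f₁ : ℝ → ℝ, Monotone f₀ ∧ Monotone f₁ ∧
      ∀ ω ∈ A, X ω = f₀ (X ω + Z ω) ∧ Z ω = f₁ (X ω + Z ω) := by
  have hmono : ∀ ω ∈ A, ∀ ω' ∈ A, X ω + Z ω ≤ X ω' + Z ω' → X ω ≤ X ω' ∧ Z ω ≤ Z ω' := by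
    intro ω hω ω' hω' hle
    rcases lt_trichotomy (Z ω) (Z ω') with h1 | h1 | h1
    · exact ⟨h ω hω ω' hω' h1, h1.le⟩
    · exact ⟨by linarith, h1.le⟩
    · have := h ω' hω' ω hω h1
      constructor <;> linarith
  have key : ∀ (Y : Ω → ℝ) (c : ℝ), (∀ ω ∈ A, |Y ω| ≤ c) →
      (∀ ω ∈ A, ∀ ω' ∈ A, X ω + Z ω ≤ X ω' + Z ω' → Y ω ≤ Y ω') →
      ∃ f : ℝ → ℝ, Monotone f ∧ ∀ ω ∈ A, Y ω = f (X ω + Z ω) := by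
    intro Y c hc hY
    have hs : ∀ v : ((fun ω => X ω + Z ω) '' A : Set ℝ), ∃ ω ∈ A, X ω + Z ω = v := fun v => v.2
    choose s hsA hs using hs
    classical
    let k : ℝ → ℝ := fun v => if hv : v ∈ (fun ω => X ω + Z ω) '' A then Y (s ⟨v, hv⟩) else 0
    have hk : ∀ ω ∈ A, k (X ω + Z ω) = Y ω := by
      intro ω hω
      have hv : X ω + Z ω ∈ (fun ω => X ω + Z ω) '' A := ⟨ω, hω, rfl⟩
      simp only [k, dif_pos hv]
      have := hs ⟨_, hv⟩
      exact le_antisymm (hY _ (hsA _) _ hω this.le) (hY _ hω _ (hsA _) this.ge)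
    have hkm : MonotoneOn k ((fun ω => X ω + Z ω) '' A) := by
      rintro _ ⟨ω, hω, rfl⟩ _ ⟨ω', hω', rfl⟩ hle
      simp only [hk ω hω, hk ω' hω']
      exact hY ω hω ω' hω' hle
    -- The bounds on `X` and `Z` serve here: a bounded monotone function extends from a subset to
    -- all of `ℝ`.
    obtain ⟨f, hf, hfk⟩ := hkm.exists_monotone_extension
      ⟨-c, by rintro _ ⟨_, ⟨ω, hω, rfl⟩, rfl⟩; simp only [hk ω hω]; exact (abs_le.1 (hc ω hω)).1⟩
      ⟨c, by rintro _ ⟨_, ⟨ω, hω, rfl⟩, rfl⟩; simp only [hk ω hω]; exact (abs_le.1 (hc ω hω)).2⟩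
    exact ⟨f, hf, fun ω hω => by rw [← hk ω hω]; exact hfk ⟨ω, hω, rfl⟩⟩
  obtain ⟨f₀, hf₀, h₀⟩ := key X a hXA fun ω hω ω' hω' hle => (hmono ω hω ω' hω' hle).1
  obtain ⟨f₁, hf₁, h₁⟩ := key Z b hZA fun ω hω ω' hω' hle => (hmono ω hω ω' hω' hle).2
  exact ⟨f₀, f₁, hf₀, hf₁, fun ω hω => ⟨h₀ ω hω, h₁ ω hω⟩⟩

/-! ### Plateaus, points of strict increase and the preorder -/

/-- `g₁` is constant on the half-open intervals on which `g₂` is constant. -/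
def ConstantOnPlateaus (g₁ g₂ : ℝ → ℝ) : Prop :=
  ∀ a b, 0 ≤ a → a < b → b ≤ 1 → g₂ a = g₂ b → ∀ t ∈ Ioc a b, g₁ t = g₁ b

/-- A point outside `𝓘(g₂)` has a plateau of `g₂` on each side available in `[0,1]`, and there `g₁`
is constant too. -/
theorem ConstantOnPlateaus.strictIncreaseSet_subset {g₁ g₂ : ℝ → ℝ}
    (hg₁ : IsG g₁) (hg₂ : IsG g₂) (h : ConstantOnPlateaus g₁ g₂) :
    strictIncreaseSet g₁ ⊆ strictIncreaseSet g₂ := by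
  intro p hp
  have hpI : p ∈ Icc (0 : ℝ) 1 := by
    rcases hp with hp | hp
    exacts [⟨hp.1.1, hp.1.2.le⟩, ⟨hp.1.1.le, hp.1.2⟩]
  by_contra hnot
  have hnot' : ¬ IsPSIR g₂ p ∧ ¬ IsPSIL g₂ p := not_or.1 hnot
  have hR : p < 1 → ∃ s, p < s ∧ s ≤ 1 ∧ g₂ p = g₂ s := by
    intro hp1
    by_contra! hc
    exact hnot'.1 ⟨⟨hpI.1, hp1⟩, fun s hs => lt_of_le_of_ne
      (hg₂.mono hpI ⟨hpI.1.trans hs.1.le, hs.2⟩ hs.1.le) (hc s hs.1 hs.2)⟩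
  have hL : 0 < p → ∃ s, 0 ≤ s ∧ s < p ∧ g₂ s = g₂ p := by
    intro hp0
    by_contra! hc
    exact hnot'.2 ⟨⟨hp0, hpI.2⟩, fun s hs => lt_of_le_of_ne
      (hg₂.mono ⟨hs.1, hs.2.le.trans hpI.2⟩ hpI hs.2.le) (hc s hs.1 hs.2)⟩
  rcases hp with hp | hp
  · obtain ⟨s, hps, hs1, hs⟩ := hR hp.1.2
    -- The half-open plateau misses its left endpoint: at `0` right-continuity makes up for it,
    -- elsewhere the plateau on the left is joined to that on the right.
    rcases hpI.1.eq_or_lt with rfl | hp0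
    · have h1 := h 0 s le_rfl hps hs1 hs
      have h2 : ∀ᶠ t in nhdsWithin 0 (Icc (0 : ℝ) 1), g₁ t < g₁ s :=
        hg₁.right_cont_zero.eventually_lt_const (hp.2 s ⟨hps, hs1⟩)
      rw [nhdsWithin_Icc_eq_nhdsGE zero_lt_one] at h2
      have h3 := h2.filter_mono (nhdsWithin_mono _ Ioi_subset_Ici_self)
      obtain ⟨t, ht, ht'⟩ := (h3.and (Ioc_mem_nhdsGT hps)).exists
      exact ht.ne (h1 t ht')
    · obtain ⟨r, hr0, hrp, hr⟩ := hL hp0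
      have h1 := h r s hr0 (hrp.trans hps) hs1 (hr.trans hs)
      exact (hp.2 s ⟨hps, hs1⟩).ne (h1 p ⟨hrp, hps.le⟩)
  · obtain ⟨r, hr0, hrp, hr⟩ := hL hp.1.1
    have h1 := h r p hr0 hrp hpI.2 hr
    obtain ⟨t, hrt, htp⟩ := exists_between hrp
    exact (hp.2 t ⟨hr0.trans hrt.le, htp⟩).ne (h1 t ⟨hrt, htp.le⟩)

/-- Interior points of a plateau of `g₂` are not in `𝓘(g₁)`, so from each of them `g₁` stays
constant a little to the right; left-continuity carries the value to the supremum of such points. -/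
theorem ConstantOnPlateaus.of_strictIncreaseSet_subset {g₁ g₂ : ℝ → ℝ}
    (hg₁ : IsG g₁) (hg₂ : IsG g₂) (h : strictIncreaseSet g₁ ⊆ strictIncreaseSet g₂) :
    ConstantOnPlateaus g₁ g₂ := by
  intro a b ha hab hb hgab t ht
  have hI : ∀ u ∈ Icc a b, u ∈ Icc (0 : ℝ) 1 := fun u hu => ⟨ha.trans hu.1, hu.2.trans hb⟩
  have hflat : ∀ u ∈ Icc a b, g₂ u = g₂ a := by
    intro u hu
    refine le_antisymm ?_ (hg₂.mono (hI a ⟨le_rfl, hab.le⟩) (hI u hu) hu.1)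
    rw [hgab]
    exact hg₂.mono (hI u hu) (hI b ⟨hab.le, le_rfl⟩) hu.2
  have hnotR : ∀ u ∈ Ioo a b, ∃ s, u < s ∧ s ≤ 1 ∧ g₁ s ≤ g₁ u := by
    intro u hu
    by_contra! hc
    have hu1 : u < 1 := hu.2.trans_le hb
    have hu0 : 0 < u := ha.trans_lt hu.1
    rcases h (Or.inl ⟨⟨hu0.le, hu1⟩, fun s hs => hc s hs.1 hs.2⟩ : u ∈ strictIncreaseSet g₁)
      with h1 | h1
    · have := h1.2 b ⟨hu.2, hb⟩
      rw [hflat u ⟨hu.1.le, hu.2.le⟩, hgab] at this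
      exact this.false
    · have := h1.2 a ⟨ha, hu.1⟩
      rw [hflat u ⟨hu.1.le, hu.2.le⟩] at this
      exact this.false
  have htI : t ∈ Icc (0 : ℝ) 1 := hI t ⟨ht.1.le, ht.2⟩
  let S : Set ℝ := {s | s ∈ Icc t b ∧ g₁ s = g₁ t}
  have htS : t ∈ S := ⟨⟨le_rfl, ht.2⟩, rfl⟩
  have hbdd : BddAbove S := ⟨b, fun s hs => hs.1.2⟩
  set σ := sSup S with hσ
  have htσ : t ≤ σ := le_csSup hbdd htS
  have hσb : σ ≤ b := csSup_le ⟨t, htS⟩ fun s hs => hs.1.2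
  have haσ : a < σ := ht.1.trans_le htσ
  have hσI : σ ∈ Icc (0 : ℝ) 1 := hI σ ⟨haσ.le, hσb⟩
  have hgσ : g₁ σ = g₁ t := by
    refine le_antisymm ?_ (hg₁.mono htI hσI htσ)
    by_contra! hlt
    have h2 := (hg₁.left_cont σ ⟨ha.trans_lt haσ, hσI.2⟩).eventually_const_lt hlt
    rw [nhdsWithin_Icc_eq_nhdsLE (ha.trans_lt haσ)] at h2
    obtain ⟨r, hr, hrσ⟩ := (mem_nhdsLE_iff_exists_Ioc_subset' (ha.trans_lt haσ)).1 h2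
    obtain ⟨s, hsS, hs⟩ := exists_lt_of_lt_csSup ⟨t, htS⟩ hr
    exact (hrσ ⟨hs, le_csSup hbdd hsS⟩ : g₁ t < g₁ s).ne' hsS.2
  rcases hσb.eq_or_lt with hσb | hσb
  · rw [← hσb, hgσ]
  · obtain ⟨s, hs, hs1, hgs⟩ := hnotR σ ⟨haσ, hσb⟩
    have hm : σ < min s b := lt_min hs hσb
    have hmI : min s b ∈ Icc (0 : ℝ) 1 := ⟨hσI.1.trans hm.le, (min_le_left _ _).trans hs1⟩
    have : min s b ∈ S := by
      refine ⟨⟨htσ.trans hm.le, min_le_right _ _⟩, le_antisymm ?_ (hg₁.mono htI hmI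
        (htσ.trans hm.le))⟩
      rw [← hgσ]
      exact (hg₁.mono hmI ⟨hσI.1.trans hs.le, hs1⟩ (min_le_left _ _)).trans hgs
    exact absurd (le_csSup hbdd this) (not_le.2 hm)

/-- A value of `g₁` on the plateau other than `k (g₂ a)` would persist, by left-continuity, on an
interval of positive measure. -/
theorem Precedes.constantOnPlateaus {g₁ g₂ : ℝ → ℝ} (hg₁ : IsG g₁) (hg₂ : IsG g₂)
    (h : Precedes g₁ g₂) : ConstantOnPlateaus g₁ g₂ := by
  obtain ⟨k, -, hk⟩ := h
  intro a b ha hab hb hgab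
  have key : ∀ t ∈ Ioc a b, g₁ t = k (g₂ a) := by
    intro t ht
    by_contra hne
    have ht0 : 0 < t := ha.trans_lt ht.1
    have h1 := (hg₁.left_cont t ⟨ht0, ht.2.trans hb⟩).eventually_ne hne
    rw [nhdsWithin_Icc_eq_nhdsLE ht0] at h1
    obtain ⟨r, hr, hrt⟩ := (mem_nhdsLE_iff_exists_Ioc_subset' ht0).1 h1
    have hm : max a r < t := max_lt ht.1 hr
    rw [ae_restrict_iff' measurableSet_Icc] at hk
    have h2 : volume {u : ℝ | ¬ (u ∈ Icc (0 : ℝ) 1 → g₁ u = k (g₂ u))} = 0 := hk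
    have h3 : volume (Ioo (max a r) t) ≤ 0 := by
      rw [← h2]
      refine measure_mono fun u hu hc => ?_
      have hau : a < u := (le_max_left _ _).trans_lt hu.1
      have hub : u ≤ b := hu.2.le.trans ht.2
      have huI : u ∈ Icc (0 : ℝ) 1 := ⟨ha.trans hau.le, hub.trans hb⟩
      have hg : g₂ u = g₂ a := by
        refine le_antisymm ?_ (hg₂.mono ⟨ha, hab.le.trans hb⟩ huI hau.le)
        rw [hgab]
        exact hg₂.mono huI ⟨ha.trans hab.le, hb⟩ hub
      have h4 := hrt (show u ∈ Ioc r t from ⟨(le_max_right _ _).trans_lt hu.1, hu.2.le⟩)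
      exact h4 (by rw [hc huI, hg])
    rw [Real.volume_Ioo, nonpos_iff_eq_zero, ENNReal.ofReal_eq_zero] at h3
    linarith
  intro t ht
  rw [key t ht, key b ⟨hab, le_rfl⟩]

theorem ConstantOnPlateaus.precedes {g₁ g₂ : ℝ → ℝ} (hg₁ : IsG g₁) (hg₂ : IsG g₂)
    (h : ConstantOnPlateaus g₁ g₂) : Precedes g₁ g₂ := by
  -- The increasing function will be `y ↦ sup {g₁ t : g₂ t ≤ y}`; inserting `0` covers `y < g₂ 0`.
  let T : ℝ → Set ℝ := fun y => insert 0 {t | t ∈ Icc (0 : ℝ) 1 ∧ g₂ t ≤ y}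
  have hT : ∀ y, T y ⊆ Icc 0 1 := by
    rintro y t (rfl | ht)
    exacts [⟨le_rfl, zero_le_one⟩, ht.1]
  have hbdd : ∀ y, BddAbove (g₁ '' T y) := by
    refine fun y => ⟨g₁ 1, ?_⟩
    rintro _ ⟨t, ht, rfl⟩
    exact hg₁.mono (hT y ht) ⟨zero_le_one, le_rfl⟩ (hT y ht).2
  have hne : ∀ y, (g₁ '' T y).Nonempty := fun y => ⟨g₁ 0, 0, mem_insert _ _, rfl⟩
  refine ⟨fun y => sSup (g₁ '' T y), fun y z hyz => csSup_le_csSup (hbdd z) (hne y) ?_, ?_⟩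
  · exact image_mono (insert_subset_insert fun t ht => ⟨ht.1, ht.2.trans hyz⟩)
  -- At the left end of a plateau `g₁` may jump, and the supremum then exceeds `g₁ s`; continuity
  -- points of `g₁` avoid this.
  filter_upwards [ae_restrict_mem measurableSet_Icc,
    ae_restrict_of_ae (hg₁.mono.countable_not_continuousWithinAt.ae_notMem volume)] with s hs hc
  have hcont : ContinuousWithinAt g₁ (Icc 0 1) s := by
    by_contra hc'
    exact hc ⟨hs, hc'⟩
  refine le_antisymm (le_csSup (hbdd _) ⟨s, Or.inr ⟨hs, le_rfl⟩, rfl⟩) (csSup_le (hne _) ?_)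
  rintro _ ⟨t, ht, rfl⟩
  have htI := hT _ ht
  rcases le_or_gt t s with hts | hst
  · exact hg₁.mono htI hs hts
  have hgt : g₂ s = g₂ t := by
    refine le_antisymm (hg₂.mono hs htI hst.le) ?_
    rcases ht with rfl | ht
    · exact absurd hs.1 (not_le.2 hst)
    · exact ht.2
  by_contra! hlt
  have h2 := hcont.eventually_lt_const hlt
  have h3 : ∀ᶠ u in nhdsWithin s (Ioc s t), g₁ u < g₁ t :=
    h2.filter_mono (nhdsWithin_mono _ (Ioc_subset_Icc_self.trans (Icc_subset_Icc hs.1 htI.2)))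
  rw [nhdsWithin_Ioc_eq_nhdsGT hst] at h3
  obtain ⟨u, hu, hu'⟩ := (h3.and (Ioc_mem_nhdsGT hst)).exists
  exact hu.ne (h s t hs.1 hst htI.2 hgt u hu')

/-! ### Sufficiency: additivity from the preorder -/

theorem spectralRisk_eq_setIntegral {Ω : Type*} [MeasurableSpace Ω] (P : Measure Ω) (g : ℝ → ℝ)
    (X : Ω → ℝ) : spectralRisk P g X = ∫ t in Ioo (0 : ℝ) 1, g t * leftQuantile P X t := by
  rw [spectralRisk, intervalIntegral.integral_of_le zero_le_one, integral_Ioc_eq_integral_Ioo]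
  refine setIntegral_congr_fun measurableSet_Ioo fun t ht => ?_
  simp only [quantile, if_neg ht.1.ne']

theorem exists_ae_abs_le_of_memLp_top {Ω : Type*} [MeasurableSpace Ω] {P : Measure Ω}
    {X : Ω → ℝ} (hX : MemLp X ∞ P) : ∃ a, ∀ᵐ ω ∂P, |X ω| ≤ a := by
  have h2 : eLpNormEssSup X P ≠ ∞ := by
    have := hX.2
    rw [eLpNorm_exponent_top] at this
    exact this.ne
  refine ⟨(eLpNormEssSup X P).toReal, ?_⟩
  filter_upwards [ae_le_eLpNormEssSup (f := X) (μ := P)] with ω hω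
  rw [← Real.norm_eq_abs, ← toReal_enorm]
  exact ENNReal.toReal_mono h2 hω

theorem Precedes.gAdditive {Ω : Type*} [MeasurableSpace Ω] (P : Measure Ω)
    [IsProbabilityMeasure P] {g₁ g₂ : ℝ → ℝ} (hg₂ : IsG g₂) (h : Precedes g₁ g₂) :
    GAdditive P g₂ (spectralRisk P g₁) := by
  obtain ⟨k, hk, hgk⟩ := h
  rintro d X hX ⟨Z, hZm, hZq, hco⟩
  have hZq' : ∀ t ∈ Ioo (0 : ℝ) 1, leftQuantile P Z t = g₂ t := by
    intro t ht
    rw [← hZq t ⟨ht.1.le, ht.2.le⟩, quantile, if_neg ht.1.ne']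
  -- The weight `k (Z ω)` does not depend on `Y` or `W`, so the right-hand side is linear across
  -- components that have different common variables `W i`.
  have hrisk : ∀ (W Y : Ω → ℝ) (f₀ f₁ : ℝ → ℝ), AEMeasurable W P → Monotone f₀ → Monotone f₁ →
      (Y =ᵐ[P] fun ω => f₀ (W ω)) → (Z =ᵐ[P] fun ω => f₁ (W ω)) →
      spectralRisk P g₁ Y = ∫ ω, k (Z ω) * Y ω ∂P := by
    intro W Y f₀ f₁ hW hf₀ hf₁ hY hZ
    rw [spectralRisk_eq_setIntegral, integral_mul_eq_of_monotone hW hf₀ hf₁ hk hY hZ]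
    refine integral_congr_ae ?_
    filter_upwards [ae_restrict_of_ae_restrict_of_subset Ioo_subset_Icc_self hgk,
      ae_restrict_mem measurableSet_Ioo] with t ht ht'
    rw [ht, hZq' t ht']
  have hZI : ∀ᵐ ω ∂P, Z ω ∈ Icc (g₂ 0) (g₂ 1) := by
    have hq : AEMeasurable (leftQuantile P Z) (volume.restrict (Ioo (0 : ℝ) 1)) :=
      aemeasurable_restrict_of_monotoneOn measurableSet_Ioo
        (monotoneOn_leftQuantile hZm.aemeasurable)
    refine ae_of_ae_map (p := fun z => z ∈ Icc (g₂ 0) (g₂ 1)) hZm.aemeasurable ?_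
    rw [← map_leftQuantile hZm.aemeasurable]
    refine (ae_map_iff (p := fun z => z ∈ Icc (g₂ 0) (g₂ 1)) hq measurableSet_Icc).2 ?_
    filter_upwards [ae_restrict_mem measurableSet_Ioo] with t ht
    rw [hZq' t ht]
    exact ⟨hg₂.mono ⟨le_rfl, zero_le_one⟩ ⟨ht.1.le, ht.2.le⟩ ht.1.le,
      hg₂.mono ⟨ht.1.le, ht.2.le⟩ ⟨zero_le_one, le_rfl⟩ ht.2.le⟩
  choose W f hWm hf hWf using hco
  have hS : MemLp (fun ω => ∑ i, X i ω) ∞ P := memLp_finsetSum _ fun i _ => hX i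
  obtain ⟨a, ha⟩ := exists_ae_abs_le_of_memLp_top hS
  let A : Set Ω := {ω | (∀ i, X i ω = f i 0 (W i ω) ∧ Z ω = f i 1 (W i ω)) ∧
    |∑ i, X i ω| ≤ a ∧ |Z ω| ≤ max |g₂ 0| |g₂ 1|}
  have hWf' : ∀ᵐ ω ∂P, ∀ i, X i ω = f i 0 (W i ω) ∧ Z ω = f i 1 (W i ω) := by
    refine ae_all_iff.2 fun i => ?_
    filter_upwards [hWf i] with ω hω
    exact ⟨hω 0, hω 1⟩
  have hA : ∀ᵐ ω ∂P, ω ∈ A := by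
    filter_upwards [hWf', ha, hZI] with ω h1 h2 h3
    exact ⟨h1, h2, abs_le_max_abs_abs h3.1 h3.2⟩
  obtain ⟨f₀, f₁, hf₀, hf₁, hff⟩ := exists_monotone_of_add (A := A) (fun ω hω => hω.2.1)
    (fun ω hω => hω.2.2) (by
      intro ω hω ω' hω' hlt
      refine Finset.sum_le_sum fun i _ => ?_
      rw [(hω.1 i).1, (hω'.1 i).1]
      rw [(hω.1 i).2, (hω'.1 i).2] at hlt
      exact hf i 0 ((hf i 1).reflect_lt hlt).le)
  -- The sum and `Z` are both increasing functions of their own total.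
  rw [hrisk (fun ω => (∑ i, X i ω) + Z ω) _ f₀ f₁
    (hS.1.aemeasurable.add hZm.aemeasurable) hf₀ hf₁
    (by filter_upwards [hA] with ω hω using (hff ω hω).1)
    (by filter_upwards [hA] with ω hω using (hff ω hω).2)]
  have hint : ∀ i, Integrable (fun ω => k (Z ω) * X i ω) P := by
    intro i
    refine ((hX i).integrable le_top).bdd_mul (c := max |k (g₂ 0)| |k (g₂ 1)|)
      (hk.measurable.comp hZm).aestronglyMeasurable ?_
    filter_upwards [hZI] with ω hω
    exact abs_le_max_abs_abs (hk hω.1) (hk hω.2)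
  simp only [Finset.mul_sum]
  rw [integral_finsetSum _ fun i _ => hint i]
  refine Finset.sum_congr rfl fun i _ => ?_
  rw [hrisk (W i) _ (f i 0) (f i 1) (hWm i).aemeasurable (hf i 0) (hf i 1)
    (by filter_upwards [hWf'] with ω hω using (hω i).1)
    (by filter_upwards [hWf'] with ω hω using (hω i).2)]

/-! ### Necessity: reflection on a plateau -/

/-- A function in `𝒢`, applied to a uniform random variable, is its own quantile function. -/
theorem quantile_comp_uniform {Ω : Type*} [MeasurableSpace Ω] {P : Measure Ω}
    {U : Ω → ℝ} (hU : Measurable U) (hUP : P.map U = volume.restrict (Icc (0 : ℝ) 1))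
    (hUI : ∀ ω, U ω ∈ Icc (0 : ℝ) 1) {g : ℝ → ℝ} (hg : IsG g) {Z : Ω → ℝ}
    (hZ : ∀ ω, Z ω = g (U ω)) {p : ℝ} (hp : p ∈ Icc (0 : ℝ) 1) : quantile P Z p = g p := by
  have hfin : IsFiniteMeasure P := by
    have : IsFiniteMeasure (P.map U) := by rw [hUP]; infer_instance
    exact Measure.isFiniteMeasure_of_map hU.aemeasurable
  have hPU : ∀ x ∈ Icc (0 : ℝ) 1, P.real {ω | U ω ≤ x} = x := by
    intro x hx
    change P.real (U ⁻¹' Iic x) = x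
    rw [← map_measureReal_apply hU measurableSet_Iic, hUP,
      measureReal_restrict_apply measurableSet_Iic]
    have : (Iic x ∩ Icc 0 1 : Set ℝ) = Icc 0 x := by
      ext y
      simp only [mem_inter_iff, mem_Iic, mem_Icc]
      exact ⟨fun h => ⟨h.2.1, h.1⟩, fun h => ⟨h.2, h.1, h.2.trans hx.2⟩⟩
    rw [this, Real.volume_real_Icc_of_le hx.1, sub_zero]
  have hle : ∀ x ∈ Icc (0 : ℝ) 1, ∀ y, g x ≤ y → x ≤ P.real {ω | Z ω ≤ y} := by
    intro x hx y hy
    conv_lhs => rw [← hPU x hx]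
    refine measureReal_mono fun ω (hω : U ω ≤ x) => ?_
    change Z ω ≤ y
    rw [hZ]
    exact (hg.mono (hUI ω) hx hω).trans hy
  have hge : ∀ x ∈ Icc (0 : ℝ) 1, ∀ y, y < g x → P.real {ω | Z ω ≤ y} ≤ x := by
    intro x hx y hy
    conv_rhs => rw [← hPU x hx]
    refine measureReal_mono fun ω (hω : Z ω ≤ y) => ?_
    change U ω ≤ x
    by_contra! hlt
    rw [hZ] at hω
    exact ((hg.mono hx (hUI ω) hlt.le).trans hω).not_gt hy
  have h0 : (0 : ℝ) ∈ Icc (0 : ℝ) 1 := ⟨le_rfl, zero_le_one⟩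
  unfold quantile
  split_ifs with hp0
  · subst hp0
    have hlb : ∀ x ∈ {x : ℝ | 0 < P.real {ω | Z ω ≤ x}}, g 0 ≤ x := by
      intro x (hx : 0 < P.real {ω | Z ω ≤ x})
      by_contra! hlt
      exact (hge 0 h0 x hlt).not_gt hx
    have hub : ∀ x, g 0 < x → x ∈ {x : ℝ | 0 < P.real {ω | Z ω ≤ x}} := by
      intro x hx
      have h2 := hg.right_cont_zero.eventually_lt_const hx
      rw [nhdsWithin_Icc_eq_nhdsGE zero_lt_one] at h2
      have h3 := h2.filter_mono (nhdsWithin_mono _ Ioi_subset_Ici_self)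
      obtain ⟨t, ht, ht'⟩ := (h3.and (Ioc_mem_nhdsGT (zero_lt_one (α := ℝ)))).exists
      exact ht'.1.trans_le (hle t ⟨ht'.1.le, ht'.2⟩ x ht.le)
    refine le_antisymm ?_ (le_csInf ⟨g 0 + 1, hub _ (by linarith)⟩ hlb)
    exact le_of_forall_gt_imp_ge_of_dense fun x hx => csInf_le ⟨g 0, hlb⟩ (hub x hx)
  · have hp0 : 0 < p := lt_of_le_of_ne hp.1 (Ne.symm hp0)
    refine IsLeast.csInf_eq ⟨hle p hp _ le_rfl, fun x (hx : p ≤ P.real {ω | Z ω ≤ x}) => ?_⟩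
    by_contra! hlt
    have h1 := (hg.left_cont p ⟨hp0, hp.2⟩).eventually_const_lt hlt
    rw [nhdsWithin_Icc_eq_nhdsLE hp0] at h1
    obtain ⟨r, hr, hrp⟩ := (mem_nhdsLE_iff_exists_Ioc_subset' hp0).1 h1
    obtain ⟨s, hs, hsp⟩ := exists_between (max_lt hr hp0)
    have h2 : x < g s := hrp (show s ∈ Ioc r p from ⟨(le_max_left _ _).trans_lt hs, hsp.le⟩)
    have h3 := hge s ⟨((le_max_right _ _).trans_lt hs).le, hsp.le.trans hp.2⟩ x h2
    linarith

theorem spectralRisk_eq_of_uniform {Ω : Type*} [MeasurableSpace Ω] {P : Measure Ω}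
    [IsProbabilityMeasure P] {U : Ω → ℝ} (hU : Measurable U)
    (hUP : P.map U = volume.restrict (Icc (0 : ℝ) 1)) (g : ℝ → ℝ) {k : ℝ → ℝ} (hk : Monotone k)
    {X : Ω → ℝ} (hX : X =ᵐ[P] fun ω => k (U ω)) :
    spectralRisk P g X = ∫ t in (0 : ℝ)..1, g t * k t := by
  rw [spectralRisk_eq_setIntegral, intervalIntegral.integral_of_le zero_le_one,
    integral_Ioc_eq_integral_Ioo]
  refine integral_congr_ae ?_
  have hXm : AEMeasurable X P := (hk.measurable.comp_aemeasurable hU.aemeasurable).congr hX.symm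
  have hmap : P.map X = (volume.restrict (Ioo (0 : ℝ) 1)).map k := by
    rw [Measure.map_congr hX, ← Measure.restrict_congr_set Ioo_ae_eq_Icc.symm, ← hUP,
      Measure.map_map hk.measurable hU]
    rfl
  filter_upwards [leftQuantile_ae_eq_of_map_eq hXm (hk.monotoneOn _) hmap] with t ht
  rw [ht]

/-- Needed for the reflected indicator, which is not a monotone function of the uniform variable. -/
theorem leftQuantile_indicator_congr {Ω : Type*} [MeasurableSpace Ω] {P : Measure Ω}
    [IsProbabilityMeasure P] {A B : Set Ω} (hA : MeasurableSet A) (hB : MeasurableSet B)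
    (h : P.real A = P.real B) :
    leftQuantile P (A.indicator 1) = leftQuantile P (B.indicator 1) := by
  have key : ∀ (A : Set Ω) (x : ℝ), {ω | A.indicator (1 : Ω → ℝ) ω ≤ x} =
      if x < 0 then ∅ else if x < 1 then Aᶜ else univ := by
    intro A x
    ext ω
    by_cases hω : ω ∈ A <;> split_ifs <;> simp [hω] <;> linarith
  have hF : ∀ x, P.real {ω | A.indicator (1 : Ω → ℝ) ω ≤ x} =
      P.real {ω | B.indicator (1 : Ω → ℝ) ω ≤ x} := by
    intro x
    rw [key, key]
    split_ifs
    · rfl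
    · rw [probReal_compl_eq_one_sub hA, probReal_compl_eq_one_sub hB, h]
    · rfl
  unfold leftQuantile
  simp only [hF]

theorem monotone_indicator_Ioi_one (c : ℝ) : Monotone ((Ioi c).indicator (1 : ℝ → ℝ)) := by
  intro x y hxy
  by_cases hx : c < x
  · have hy : c < y := hx.trans_le hxy
    simp [hx, hy]
  · by_cases hy : c < y <;> simp [hx, hy]

theorem intervalIntegrable_of_monotoneOn_Icc {g : ℝ → ℝ} (hg : MonotoneOn g (Icc 0 1))
    {x y : ℝ} (hx : x ∈ Icc (0 : ℝ) 1) (hy : y ∈ Icc (0 : ℝ) 1) :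
    IntervalIntegrable g volume x y :=
  MonotoneOn.intervalIntegrable (hg.mono (uIcc_subset_Icc hx hy))

theorem intervalIntegral_mul_indicator_Ioi {g : ℝ → ℝ} (hg : MonotoneOn g (Icc 0 1)) {c : ℝ}
    (hc : c ∈ Icc (0 : ℝ) 1) :
    IntervalIntegrable (fun t => g t * (Ioi c).indicator 1 t) volume 0 1 ∧
      ∫ t in (0 : ℝ)..1, g t * (Ioi c).indicator 1 t = ∫ t in c..1, g t := by
  have h1 : (fun t => g t * (Ioi c).indicator 1 t) = (Ioi c).indicator g := by
    ext t
    by_cases ht : c < t <;> simp [ht]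
  have hgi := intervalIntegrable_of_monotoneOn_Icc hg ⟨le_rfl, zero_le_one⟩
    ⟨zero_le_one, le_rfl⟩
  rw [h1]
  constructor
  · rw [intervalIntegrable_iff_integrableOn_Ioc_of_le zero_le_one] at hgi ⊢
    exact hgi.indicator measurableSet_Ioi
  · rw [intervalIntegral.integral_of_le zero_le_one, intervalIntegral.integral_of_le hc.2,
      setIntegral_indicator measurableSet_Ioi]
    congr 2
    ext t
    simp only [mem_inter_iff, mem_Ioc, mem_Ioi]
    exact ⟨fun h => ⟨h.2, h.1.2⟩, fun h => ⟨⟨hc.1.trans_lt h.1, h.2⟩, h.1⟩⟩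

/-- If the integral of `g ∈ 𝒢` over the tail `[x,1]` is affine at the midpoint of `[a,b]`,
then `g` is constant on `(a,b]`. -/
theorem IsG.eq_of_integral_midpoint {g : ℝ → ℝ} (hg : IsG g) {a b : ℝ} (ha : 0 ≤ a) (hab : a < b)
    (hb : b ≤ 1) (h : (∫ t in a..1, g t) + ∫ t in b..1, g t =
      2 * ∫ t in ((a + b) / 2)..1, g t) : ∀ t ∈ Ioc a b, g t = g b := by
  set c := (a + b) / 2 with hc
  have hac : a < c := by linarith
  have hcb : c < b := by linarith
  have hI : ∀ u ∈ Icc a b, u ∈ Icc (0 : ℝ) 1 := fun u hu => ⟨ha.trans hu.1, hu.2.trans hb⟩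
  have hii : ∀ x ∈ Icc (0 : ℝ) 1, ∀ y ∈ Icc (0 : ℝ) 1, IntervalIntegrable g volume x y :=
    fun x hx y hy => intervalIntegrable_of_monotoneOn_Icc hg.mono hx hy
  have hbd : ∀ x ∈ Icc a b, ∀ y ∈ Icc a b, x ≤ y →
      (y - x) * g x ≤ ∫ t in x..y, g t ∧ ∫ t in x..y, g t ≤ (y - x) * g y := by
    intro x hx y hy hxy
    constructor
    · have := intervalIntegral.integral_mono_on (f := fun _ => g x) hxy
        intervalIntegrable_const (hii x (hI x hx) y (hI y hy))
        fun t ht => hg.mono (hI x hx) (hI t ⟨hx.1.trans ht.1, ht.2.trans hy.2⟩) ht.1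
      simpa using this
    · have := intervalIntegral.integral_mono_on (g := fun _ => g y) hxy
        (hii x (hI x hx) y (hI y hy)) intervalIntegrable_const
        fun t ht => hg.mono (hI t ⟨hx.1.trans ht.1, ht.2.trans hy.2⟩) (hI y hy) ht.2
      simpa using this
  have haI : a ∈ Icc a b := ⟨le_rfl, hab.le⟩
  have hbI : b ∈ Icc a b := ⟨hab.le, le_rfl⟩
  have hcI : c ∈ Icc a b := ⟨hac.le, hcb.le⟩
  have h1I : (1 : ℝ) ∈ Icc (0 : ℝ) 1 := ⟨zero_le_one, le_rfl⟩
  have hadd : ∀ x ∈ Icc (0 : ℝ) 1, ∀ y ∈ Icc (0 : ℝ) 1, ∀ z ∈ Icc (0 : ℝ) 1,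
      (∫ t in x..y, g t) + ∫ t in y..z, g t = ∫ t in x..z, g t := fun x hx y hy z hz =>
    intervalIntegral.integral_add_adjacent_intervals (hii x hx y hy) (hii y hy z hz)
  have e1 := hadd a (hI a haI) c (hI c hcI) 1 h1I
  have e2 := hadd c (hI c hcI) b (hI b hbI) 1 h1I
  -- The hypothesis says `∫_a^c g = ∫_c^b g`, while monotonicity puts `(c - a) g(c)` between the
  -- two; equality leaves no room for `g t ≠ g c`.
  have hin : ∀ t ∈ Ioo a b, g t = g c := by
    intro t ht
    have htI : t ∈ Icc a b := ⟨ht.1.le, ht.2.le⟩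
    rcases le_total t c with htc | hct
    · refine le_antisymm (hg.mono (hI t htI) (hI c hcI) htc) ?_
      have e3 := hadd a (hI a haI) t (hI t htI) c (hI c hcI)
      have i1 := (hbd a haI t htI ht.1.le).2
      have i2 := (hbd t htI c hcI htc).2
      have i3 := (hbd c hcI b hbI hcb.le).1
      have hbc : b - c = c - a := by rw [hc]; ring
      rw [hbc] at i3
      have : (t - a) * g c ≤ (t - a) * g t := by linarith
      exact le_of_mul_le_mul_left this (sub_pos.2 ht.1)
    · refine le_antisymm ?_ (hg.mono (hI c hcI) (hI t htI) hct)
      have e3 := hadd c (hI c hcI) t (hI t htI) b (hI b hbI)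
      have i1 := (hbd c hcI t htI hct).1
      have i2 := (hbd t htI b hbI ht.2.le).1
      have i3 := (hbd a haI c hcI hac.le).2
      have hbc : c - a = b - c := by rw [hc]; ring
      rw [hbc] at i3
      have : (b - t) * g t ≤ (b - t) * g c := by linarith
      exact le_of_mul_le_mul_left this (sub_pos.2 ht.2)
  have hgb : g b = g c := by
    refine le_antisymm ?_ (hg.mono (hI c hcI) (hI b hbI) hcb.le)
    by_contra! hlt
    have hb0 : 0 < b := ha.trans_lt hab
    have h1 := (hg.left_cont b ⟨hb0, hb⟩).eventually_const_lt hlt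
    rw [nhdsWithin_Icc_eq_nhdsLE hb0] at h1
    obtain ⟨r, hr, hrb⟩ := (mem_nhdsLE_iff_exists_Ioc_subset' hb0).1 h1
    obtain ⟨s, hs, hsb⟩ := exists_between (max_lt hr hab)
    have h2 : g c < g s := hrb (show s ∈ Ioc r b from ⟨(le_max_left _ _).trans_lt hs, hsb.le⟩)
    exact h2.ne' (hin s ⟨(le_max_right _ _).trans_lt hs, hsb⟩)
  intro t ht
  rcases ht.2.eq_or_lt with rfl | htb
  · rfl
  · rw [hin t ⟨ht.1, htb⟩, hgb]

/-- If `ρ_{g₁}` is `g₂`-additive, then `g₁` is constant where `g₂` is: otherwise two indicators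
of tail events, of a uniform variable and of its reflection on a plateau of `g₂`, violate
additivity. -/
theorem ConstantOnPlateaus.of_gAdditive {Ω : Type*} [MeasurableSpace Ω] (P : Measure Ω)
    [IsProbabilityMeasure P] (hP : Atomless P) {g₁ g₂ : ℝ → ℝ} (hg₁ : IsG g₁) (hg₂ : IsG g₂)
    (h : GAdditive P g₂ (spectralRisk P g₁)) : ConstantOnPlateaus g₁ g₂ := by
  classical
  intro a b ha hab hb hgab
  obtain ⟨U, hU, hUI, hUP⟩ := exists_uniform P hP
  refine hg₁.eq_of_integral_midpoint ha hab hb ?_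
  set c := (a + b) / 2 with hc
  have hac : a < c := by linarith
  have hcb : c < b := by linarith
  have hI : ∀ u ∈ Icc a b, u ∈ Icc (0 : ℝ) 1 := fun u hu => ⟨ha.trans hu.1, hu.2.trans hb⟩
  have hflat : ∀ u ∈ Icc a b, g₂ u = g₂ a := by
    intro u hu
    refine le_antisymm ?_ (hg₂.mono (hI a ⟨le_rfl, hab.le⟩) (hI u hu) hu.1)
    rw [hgab]
    exact hg₂.mono (hI u hu) (hI b ⟨hab.le, le_rfl⟩) hu.2
  -- This reflection preserves Lebesgue measure on `[0,1]` and the value of `g₂`, but reverses order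
  -- inside the plateau.
  let T : ℝ → ℝ := fun u => if u ∈ Ioo a b then a + b - u else u
  have hT : Measurable T := Measurable.ite measurableSet_Ioo (by fun_prop) measurable_id
  let k : ℝ → ℝ := (Ioi c).indicator 1
  have hk : Monotone k := monotone_indicator_Ioi_one c
  -- `g₂` is monotone only on `[0,1]`; clamping gives the monotone function on `ℝ` that
  -- comonotonicity requires.
  let G : ℝ → ℝ := fun u => g₂ (projIcc 0 1 zero_le_one u)
  have hG : Monotone G := fun u v huv => hg₂.mono (projIcc _ _ _ u).2 (projIcc _ _ _ v).2
    (monotone_projIcc _ huv)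
  have hGI : ∀ u ∈ Icc (0 : ℝ) 1, G u = g₂ u := by
    intro u hu
    simp only [G, projIcc_of_mem zero_le_one hu]
  have hGT : ∀ u, G (T u) = G u := by
    intro u
    simp only [T]
    split_ifs with hu
    · have h1 : u ∈ Icc a b := ⟨hu.1.le, hu.2.le⟩
      have h2 : a + b - u ∈ Icc a b := ⟨by linarith [hu.2], by linarith [hu.1]⟩
      rw [hGI _ (hI _ h1), hGI _ (hI _ h2), hflat _ h1, hflat _ h2]
    · rfl
  have hbound : ∀ x, ‖k x‖ ≤ 1 := by
    intro x
    by_cases hx : c < x <;> simp [k, hx]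
  have hmem : ∀ V : Ω → ℝ, Measurable V → MemLp (fun ω => k (V ω)) ∞ P := fun V hV =>
    memLp_top_of_bound (hk.measurable.comp hV).aestronglyMeasurable 1
      (Filter.Eventually.of_forall fun ω => hbound _)
  have hcom : GComonotonic P g₂ ![fun ω => k (U ω), fun ω => k (T (U ω))] := by
    refine ⟨fun ω => G (U ω), hG.measurable.comp hU, fun p hp =>
      quantile_comp_uniform hU hUP hUI hg₂ (fun ω => hGI _ (hUI ω)) hp, ?_⟩
    have hmono : ∀ i, Monotone ((![k, G] : Fin 2 → ℝ → ℝ) i) := by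
      intro i
      fin_cases i
      exacts [hk, hG]
    intro i
    fin_cases i
    · refine ⟨U, ![k, G], hU, hmono, Filter.Eventually.of_forall fun ω j => ?_⟩
      fin_cases j <;> rfl
    · refine ⟨fun ω => T (U ω), ![k, G], hT.comp hU, hmono,
        Filter.Eventually.of_forall fun ω j => ?_⟩
      fin_cases j
      · rfl
      · exact (hGT (U ω)).symm
  have hadd := h 2 ![fun ω => k (U ω), fun ω => k (T (U ω))] (by
    intro i
    fin_cases i
    exacts [hmem _ hU, hmem _ (hT.comp hU)]) hcom
  simp only [Fin.sum_univ_two, Matrix.cons_val_zero, Matrix.cons_val_one] at hadd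
  have haI := hI a ⟨le_rfl, hab.le⟩
  have hbI := hI b ⟨hab.le, le_rfl⟩
  have hcI := hI c ⟨hac.le, hcb.le⟩
  have r1 : spectralRisk P g₁ (fun ω => k (U ω)) = ∫ t in c..1, g₁ t := by
    rw [spectralRisk_eq_of_uniform hU hUP g₁ hk (Filter.EventuallyEq.refl _ _)]
    exact (intervalIntegral_mul_indicator_Ioi hg₁.mono hcI).2
  have r2 : spectralRisk P g₁ (fun ω => k (T (U ω))) = ∫ t in c..1, g₁ t := by
    rw [← r1, spectralRisk_eq_setIntegral, spectralRisk_eq_setIntegral]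
    have hm : MeasurableSet (T ⁻¹' Ioi c) := hT measurableSet_Ioi
    have e1 : (fun ω => k (T (U ω))) = (U ⁻¹' (T ⁻¹' Ioi c)).indicator 1 := rfl
    have e2 : (fun ω => k (U ω)) = (U ⁻¹' (Ioi c)).indicator 1 := rfl
    have s1 : (T ⁻¹' Ioi c ∩ Icc 0 1 : Set ℝ) = Ioo a c ∪ Icc b 1 := by
      ext u
      simp only [T, mem_inter_iff, mem_preimage, mem_Ioi, mem_union, mem_Ioo, mem_Icc]
      split_ifs with hu
      · constructor
        · rintro ⟨h1, -⟩
          exact Or.inl ⟨hu.1, by linarith⟩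
        · rintro (h1 | h1)
          · exact ⟨by linarith [h1.2], by linarith [hu.1], by linarith [hu.2]⟩
          · linarith [hu.2, h1.1]
      · constructor
        · rintro ⟨h1, h2⟩
          refine Or.inr ⟨?_, h2.2⟩
          by_contra! hub
          exact hu ⟨hac.trans h1, hub⟩
        · rintro (h1 | h1)
          · exact absurd ⟨h1.1, h1.2.trans hcb⟩ hu
          · exact ⟨by linarith [h1.1], by linarith [h1.1], h1.2⟩
    have s2 : (Ioi c ∩ Icc 0 1 : Set ℝ) = Ioc c 1 := by
      ext u
      simp only [mem_inter_iff, mem_Ioi, mem_Icc, mem_Ioc]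
      exact ⟨fun h => ⟨h.1, h.2.2⟩, fun h => ⟨h.1, hcI.1.trans h.1.le, h.2⟩⟩
    have hP2 : P.real (U ⁻¹' (T ⁻¹' Ioi c)) = P.real (U ⁻¹' (Ioi c)) := by
      rw [← map_measureReal_apply hU hm, ← map_measureReal_apply hU measurableSet_Ioi, hUP,
        measureReal_restrict_apply hm, measureReal_restrict_apply measurableSet_Ioi, s1, s2,
        measureReal_union (disjoint_left.2 fun u h1 h2 => by linarith [h1.2, h2.1])
          measurableSet_Icc (by simp) (by simp), Real.volume_real_Ioo_of_le hac.le,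
        Real.volume_real_Icc_of_le hb, Real.volume_real_Ioc_of_le hcI.2]
      linarith
    rw [e1, e2, leftQuantile_indicator_congr (hU hm) (hU measurableSet_Ioi) hP2]
  have r3 : spectralRisk P g₁ (fun ω => k (U ω) + k (T (U ω))) =
      (∫ t in a..1, g₁ t) + ∫ t in b..1, g₁ t := by
    -- At these two values the identity below fails: the sum is `0` at `c` and `2` at `b`, instead
    -- of `1`.
    have hne : ∀ᵐ ω ∂P, U ω ≠ b ∧ U ω ≠ c := by
      refine ae_of_ae_map (p := fun u => u ≠ b ∧ u ≠ c) hU.aemeasurable ?_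
      rw [hUP]
      exact (Measure.ae_ne _ b).and (Measure.ae_ne _ c)
    have hae : (fun ω => k (U ω) + k (T (U ω))) =ᵐ[P]
        fun ω => (fun u => (Ioi a).indicator (1 : ℝ → ℝ) u + (Ioi b).indicator 1 u) (U ω) := by
      filter_upwards [hne] with ω hω
      generalize U ω = u at hω
      simp only [k, T, indicator_apply, mem_Ioi, mem_Ioo, Pi.one_apply]
      grind
    rw [spectralRisk_eq_of_uniform hU hUP g₁
      ((monotone_indicator_Ioi_one a).add (monotone_indicator_Ioi_one b)) hae]
    obtain ⟨ia, ea⟩ := intervalIntegral_mul_indicator_Ioi hg₁.mono haI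
    obtain ⟨ib, eb⟩ := intervalIntegral_mul_indicator_Ioi hg₁.mono hbI
    simp only [mul_add]
    rw [intervalIntegral.integral_add ia ib, ea, eb]
  rw [← r3, hadd, r1, r2, two_mul]

end PartialComonotonicity

theorem mainTheorem7 {Ω : Type*} [MeasurableSpace Ω] (P : Measure Ω) [IsProbabilityMeasure P]
    (hP : PartialComonotonicity.Atomless P) (g₁ g₂ : ℝ → ℝ)
    (hg₁ : PartialComonotonicity.IsRiskSpectrum g₁) (hg₂ : PartialComonotonicity.IsG g₂) :
    (PartialComonotonicity.GAdditive P g₂ (PartialComonotonicity.spectralRisk P g₁) ↔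
      PartialComonotonicity.Precedes g₁ g₂) ∧
    (PartialComonotonicity.Precedes g₁ g₂ ↔
      PartialComonotonicity.strictIncreaseSet g₁ ⊆
        PartialComonotonicity.strictIncreaseSet g₂) := by
  have h₁ := hg₁.toIsG
  refine ⟨⟨fun h => ?_, fun h => h.gAdditive P hg₂⟩, fun h => ?_, fun h => ?_⟩
  · exact (PartialComonotonicity.ConstantOnPlateaus.of_gAdditive P hP h₁ hg₂ h).precedes h₁ hg₂
  · exact (h.constantOnPlateaus h₁ hg₂).strictIncreaseSet_subset h₁ hg₂
  · exact (PartialComonotonicity.ConstantOnPlateaus.of_strictIncreaseSet_subset h₁ hg₂ h).precedes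
      h₁ hg₂
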